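/- Let $0<\kappa<1$. There is exactly one Weierstrass function $P_\kappa=\wp(\,\cdot\,;G_2,G_3)$ with invariants $$G_2=\tfrac1{12}(1+3\kappa^2),\qquad G_3=\tfrac1{216}(1-9\kappa^2),$$ that is, the $\wp$-function of a lattice $\Lambda\subset\mathbb C$ with $60\sum_{0\ne l\in\Lambda}l^{-4}=G_2$ and $140\sum_{0\ne l\in\Lambda}l^{-6}=G_3$. It has exactly one fundamental pair of periods $(2\Omega_\kappa,2\Omega_\kappa')$ (two numbers linearly independent over $\mathbb R$ whose integral linear combinations are precisely the periods of $P_\kappa$) with $\Omega_\kappa>0$ and $-i\,\Omega_\kappa'>0$, and this pair is given by $$\Omega_\kappa=\pi\,F(\tfrac14,\tfrac34;1;\kappa^2),\qquad \Omega_\kappa'=i\,\tfrac{1}{\sqrt2}\,\pi\,F(\tfrac14,\tfrac34;1;1-\kappa^2),$$ where $F(a,b;c;x)=\sum_{n\ge0}\frac{(a)_n(b)_n}{(c)_n}\frac{x^n}{n!}$ is the Gauss hypergeometric function. -/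

import Mathlib

/-- `f` is the Weierstrass function `℘(•; g₂, g₃)`: the Weierstrass `℘`-function of a lattice
in `ℂ` whose invariants `60 ∑ l⁻⁴` and `140 ∑ l⁻⁶` are `g₂` and `g₃`.
(The function takes the value `0` at its poles, the lattice points.) -/
def IsWeierstrassP (g₂ g₃ : ℂ) (f : ℂ → ℂ) : Prop :=
  ∃ L : PeriodPair, L.g₂ = g₂ ∧ L.g₃ = g₃ ∧ f = L.weierstrassP

/-- `(w₁, w₂)` is a fundamental pair of periods of `f`: the numbers `w₁`, `w₂` are linearly
independent over `ℝ`, and the periods of `f` are exactly their integral linear combinations. -/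
def IsFundamentalPair (f : ℂ → ℂ) (w₁ w₂ : ℂ) : Prop :=
  LinearIndependent ℝ ![w₁, w₂] ∧
    ∀ w : ℂ, Function.Periodic f w ↔ ∃ m n : ℤ, w = m * w₁ + n * w₂

/-! The argument runs backwards from the claimed periods. Take the rectangular lattice whose
half-periods are the two hypergeometric expressions and compute its invariants; existence then needs
no inversion of $(g_2,g_3)$.

For any rectangular lattice with half-periods $a$, $ib$, the values $e_3<e_2<e_1$ of $\wp$ at the
half-periods are real, and integrating $\wp'^2=4\prod(\wp-e_i)$ along the two axes writes $a$ and
$b$ as complete elliptic integrals of the differences $e_i-e_j$ (`rectangular_spec`). With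
$e_1-e_2=c^2(1-k)$ and $e_1-e_3=c^2(1+k)$, a binomial expansion gives $2ca=\pi F(k^2)$
(`ellipticIntegral_eq_hypergeometric`), and one step of the arithmetic-geometric mean gives
$2\sqrt2\,cb=\pi F(1-k^2)$ (`ellipticIntegral_complementary`). For the chosen lattice this reads
$2cF(\kappa^2)=F(k^2)$ and $2cF(1-\kappa^2)=F(1-k^2)$. As $F$ increases, $k\ne\kappa$ would force
both $2c<1$ and $2c>1$; so $k=\kappa$, $c=\tfrac12$, and the invariants follow
(`rectangular_invariants`).

Uniqueness of $\wp$ comes from its differential equation (`lattice_eq_of_g_eq`); uniqueness of the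
pair is a statement about generators of the two axis subgroups. -/

/-- The complete elliptic integral `∫ du / √((u² + A)(u² + B))` over the real line. -/
noncomputable def ellipticIntegral (A B : ℝ) : ℝ :=
  ∫ u : ℝ, 1 / √((u ^ 2 + A) * (u ^ 2 + B))

/-! ### Real elliptic integrals and their substitutions. -/

section RealIntegrals

open MeasureTheory Set Real Filter Topology

lemma ellipticIntegral_comm (A B : ℝ) : ellipticIntegral A B = ellipticIntegral B A := by
  simp only [ellipticIntegral, mul_comm]

lemma ellipticIntegral_scale {c : ℝ} (hc : 0 < c) (A B : ℝ) :
    ellipticIntegral (c ^ 2 * A) (c ^ 2 * B) = c⁻¹ * ellipticIntegral A B := by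
  have h := Measure.integral_comp_mul_left
    (fun u : ℝ ↦ 1 / √((u ^ 2 + c ^ 2 * A) * (u ^ 2 + c ^ 2 * B))) c
  have h2 : ∀ u : ℝ, 1 / √(((c * u) ^ 2 + c ^ 2 * A) * ((c * u) ^ 2 + c ^ 2 * B)) =
      (c ^ 2)⁻¹ * (1 / √((u ^ 2 + A) * (u ^ 2 + B))) := fun u ↦ by
    rw [show ((c * u) ^ 2 + c ^ 2 * A) * ((c * u) ^ 2 + c ^ 2 * B) =
      (c ^ 2) ^ 2 * ((u ^ 2 + A) * (u ^ 2 + B)) by ring, sqrt_mul (by positivity),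
      sqrt_sq (by positivity)]
    field_simp
  simp only [h2] at h
  rw [integral_const_mul, abs_of_pos (inv_pos.2 hc), smul_eq_mul] at h
  rw [ellipticIntegral, ellipticIntegral]
  field_simp at h ⊢
  linarith

lemma ellipticIntegral_eq_two_mul_integral_Ioi (A B : ℝ) :
    ellipticIntegral A B = 2 * ∫ u in Ioi (0 : ℝ), 1 / √((u ^ 2 + A) * (u ^ 2 + B)) := by
  rw [← integral_comp_abs (f := fun u : ℝ ↦ 1 / √((u ^ 2 + A) * (u ^ 2 + B)))]
  simp only [sq_abs, ellipticIntegral]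

/-- Gauss' transformation (one step of the arithmetic-geometric mean). -/
lemma ellipticIntegral_agm {a b : ℝ} (ha : 0 < a) (hb : 0 < b) :
    ellipticIntegral (((a + b) / 2) ^ 2) (a * b) = ellipticIntegral (a ^ 2) (b ^ 2) := by
  have hab := mul_pos ha hb
  set f : ℝ → ℝ := fun t ↦ (t - a * b / t) / 2
  have hf' : ∀ t ∈ Ioi (0 : ℝ), HasDerivWithinAt f ((1 + a * b / t ^ 2) / 2) (Ioi 0) t := by
    intro t ht
    have ht0 : t ≠ 0 := ne_of_gt ht
    have h := ((hasDerivAt_id t).sub ((hasDerivAt_inv ht0).const_mul (a * b))).div_const 2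
    refine (h.congr_deriv ?_).hasDerivWithinAt
    field_simp; ring
  have hinj : InjOn f (Ioi 0) := by
    intro s hs t ht h
    have hs : 0 < s := hs
    have ht : 0 < t := ht
    simp only [f] at h
    field_simp at h
    have : (s - t) * (s * t + a * b) = 0 := by linear_combination h
    rcases mul_eq_zero.1 this with h | h
    · linarith
    · have := mul_pos hs ht; linarith
  have himg : f '' Ioi 0 = univ := by
    -- The positive root of $t^2-2ut-ab=0$.
    refine eq_univ_of_forall fun u ↦ ⟨u + √(u ^ 2 + a * b), ?_, ?_⟩
    · have : |u| < √(u ^ 2 + a * b) := by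
        rw [← sqrt_sq_eq_abs]; exact sqrt_lt_sqrt (sq_nonneg u) (by linarith)
      have := neg_abs_le u
      simp only [mem_Ioi]; linarith
    · have h1 : |u| < √(u ^ 2 + a * b) := by
        rw [← sqrt_sq_eq_abs]; exact sqrt_lt_sqrt (sq_nonneg u) (by linarith)
      have h2 := neg_abs_le u
      have h3 : u + √(u ^ 2 + a * b) ≠ 0 := by linarith
      have h4 := sq_sqrt (show 0 ≤ u ^ 2 + a * b by positivity)
      simp only [f]
      field_simp
      linear_combination h4
  have key := integral_image_eq_integral_abs_deriv_smul measurableSet_Ioi hf' hinj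
    (fun u ↦ 1 / √((u ^ 2 + ((a + b) / 2) ^ 2) * (u ^ 2 + a * b)))
  rw [himg, setIntegral_univ] at key
  rw [ellipticIntegral, key, ellipticIntegral_eq_two_mul_integral_Ioi, ← integral_const_mul]
  refine setIntegral_congr_fun measurableSet_Ioi fun t ht ↦ ?_
  have ht : 0 < t := ht
  have e1 : (f t ^ 2 + ((a + b) / 2) ^ 2) * (f t ^ 2 + a * b) =
      ((t ^ 2 + a * b) / (4 * t ^ 2)) ^ 2 * ((t ^ 2 + a ^ 2) * (t ^ 2 + b ^ 2)) := by
    simp only [f]; field_simp; ring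
  have e2 : (0 : ℝ) < √((t ^ 2 + a ^ 2) * (t ^ 2 + b ^ 2)) := sqrt_pos.2 (by positivity)
  simp only [smul_eq_mul]
  rw [e1, sqrt_mul (by positivity), sqrt_sq (by positivity), abs_of_pos (by positivity)]
  field_simp
  ring

/-- Substitute $u=\sqrt B\tan\theta$. -/
lemma ellipticIntegral_eq_trig {A B : ℝ} (hA : 0 < A) (hB : 0 < B) :
    ellipticIntegral A B =
      ∫ θ in (-(π / 2))..(π / 2), 1 / √(A * cos θ ^ 2 + B * sin θ ^ 2) := by
  have hf' : ∀ t ∈ Ioo (-(π / 2)) (π / 2), HasDerivWithinAt (fun t ↦ √B * tan t)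
      (√B * (1 / cos t ^ 2)) (Ioo (-(π / 2)) (π / 2)) t := fun t ht ↦
    ((hasDerivAt_tan (cos_pos_of_mem_Ioo ht).ne').const_mul _).hasDerivWithinAt
  have hB' := sqrt_pos.2 hB
  have hinj : InjOn (fun t ↦ √B * tan t) (Ioo (-(π / 2)) (π / 2)) := fun s hs t ht h ↦
    injOn_tan hs ht (mul_left_cancel₀ hB'.ne' h)
  have himg : (fun t ↦ √B * tan t) '' Ioo (-(π / 2)) (π / 2) = univ := by
    refine eq_univ_of_forall fun u ↦ ⟨arctan (u / √B), arctan_mem_Ioo _, ?_⟩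
    simp only [tan_arctan]; field_simp
  have key := integral_image_eq_integral_abs_deriv_smul measurableSet_Ioo hf' hinj
    (fun u ↦ 1 / √((u ^ 2 + A) * (u ^ 2 + B)))
  rw [himg, setIntegral_univ] at key
  rw [ellipticIntegral, key, intervalIntegral.integral_of_le (by linarith [pi_pos]),
    integral_Ioc_eq_integral_Ioo]
  refine setIntegral_congr_fun measurableSet_Ioo fun t ht ↦ ?_
  have hc := cos_pos_of_mem_Ioo ht
  have hs := sin_sq_add_cos_sq t
  have e1 : ((√B * tan t) ^ 2 + A) * ((√B * tan t) ^ 2 + B) =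
      (√B / cos t ^ 2) ^ 2 * (A * cos t ^ 2 + B * sin t ^ 2) := by
    rw [tan_eq_sin_div_cos, mul_pow, div_pow, div_pow, sq_sqrt hB.le]
    field_simp
    linear_combination (B * sin t ^ 2 + A * cos t ^ 2) * hs
  have e2 : 0 < A * cos t ^ 2 + B * sin t ^ 2 := by positivity
  have e3 := sqrt_pos.2 e2
  simp only [smul_eq_mul]
  rw [e1, sqrt_mul (by positivity), sqrt_sq (by positivity), abs_of_pos (by positivity)]
  field_simp

/-- The length of an interval on which `f' ^ 2 = 4 (f - p) (f - q) (f - r)` and `f` maps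
bijectively onto `(r, ∞)`. -/
lemma eq_ellipticIntegral_of_ode {f f' : ℝ → ℝ} {T p q r : ℝ} (hT : 0 < T)
    (hp : p < r) (hq : q < r)
    (hf : ∀ x ∈ Ioo 0 T, HasDerivAt f (f' x) x)
    (hode : ∀ x ∈ Ioo 0 T, f' x ^ 2 = 4 * (f x - p) * (f x - q) * (f x - r))
    (hinj : InjOn f (Ioo 0 T)) (himg : f '' Ioo 0 T = Ioi r) :
    T = ellipticIntegral (r - p) (r - q) / 2 := by
  have k1 := integral_image_eq_integral_abs_deriv_smul measurableSet_Ioo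
    (fun x hx ↦ (hf x hx).hasDerivWithinAt) hinj
    (fun x ↦ 1 / √(4 * (x - p) * (x - q) * (x - r)))
  have k2 : ∫ x in Ioo 0 T, |f' x| • (1 / √(4 * (f x - p) * (f x - q) * (f x - r))) = T := by
    rw [setIntegral_congr_fun (g := fun _ ↦ (1 : ℝ)) measurableSet_Ioo]
    · simp [hT.le]
    · intro x hx
      have hr : r < f x := by
        have : f x ∈ Ioi r := himg ▸ mem_image_of_mem f hx
        exact this
      have h0 : 0 < 4 * (f x - p) * (f x - q) * (f x - r) := by
        have h1 : 0 < f x - p := by linarith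
        have h2 : 0 < f x - q := by linarith
        have h3 : 0 < f x - r := by linarith
        positivity
      simp only [smul_eq_mul]
      rw [← hode x hx] at h0 ⊢
      rw [sqrt_sq_eq_abs]
      have : f' x ≠ 0 := by rintro h; simp [h] at h0
      have := abs_pos.2 this
      field_simp
  -- The substitution $x=r+w^2$ removes the singularity at the endpoint $r$.
  have hw' : ∀ w ∈ Ioi (0 : ℝ), HasDerivWithinAt (fun w ↦ r + w ^ 2) (2 * w) (Ioi 0) w := by
    intro w _
    simpa using ((hasDerivAt_pow 2 w).const_add r).hasDerivWithinAt
  have hwinj : InjOn (fun w : ℝ ↦ r + w ^ 2) (Ioi 0) := by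
    intro s hs t ht h
    have hs : 0 < s := hs
    have ht : 0 < t := ht
    simpa [hs.le, ht.le] using h
  have hwimg : (fun w : ℝ ↦ r + w ^ 2) '' Ioi 0 = Ioi r := by
    ext x
    constructor
    · rintro ⟨w, hw, rfl⟩
      have hw : 0 < w := hw
      have := pow_pos hw 2
      simpa using this
    · intro hx
      have hx : r < x := hx
      exact ⟨√(x - r), sqrt_pos.2 (by linarith), by simp [sq_sqrt (sub_pos.2 hx).le]⟩
  have k3 := integral_image_eq_integral_abs_deriv_smul measurableSet_Ioi hw' hwinj
    (fun x ↦ 1 / √(4 * (x - p) * (x - q) * (x - r)))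
  rw [himg, k2] at k1
  rw [hwimg, k1] at k3
  rw [k3, ellipticIntegral_eq_two_mul_integral_Ioi, mul_div_cancel_left₀ _ two_ne_zero]
  refine setIntegral_congr_fun measurableSet_Ioi fun w hw ↦ ?_
  have hw : 0 < w := hw
  have e1 : 4 * (r + w ^ 2 - p) * (r + w ^ 2 - q) * (r + w ^ 2 - r) =
      (2 * w) ^ 2 * ((w ^ 2 + (r - p)) * (w ^ 2 + (r - q))) := by ring
  have h1 : 0 < r - p := by linarith
  have h2 : 0 < r - q := by linarith
  have := sqrt_pos.2 (show 0 < (w ^ 2 + (r - p)) * (w ^ 2 + (r - q)) by positivity)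
  simp only [smul_eq_mul]
  rw [e1, sqrt_mul (by positivity), sqrt_sq (by positivity), abs_of_pos (by positivity)]
  field_simp

end RealIntegrals

/-! ### The series F(1/4, 3/4; 1; x). -/

section Hypergeometric

open MeasureTheory Set Real Filter Topology
open scoped Nat

/-- The coefficients of the series `F(1/4, 3/4; 1; x)`. -/
noncomputable abbrev quarterCoeff (n : ℕ) : ℝ :=
  ordinaryHypergeometricCoefficient (1 / 4 : ℝ) (3 / 4) 1 n

lemma quarterCoeff_succ (n : ℕ) :
    quarterCoeff (n + 1) = (1 / 4 + n) * (3 / 4 + n) / (n + 1) ^ 2 * quarterCoeff n := by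
  have h : (ascPochhammer ℝ n).eval 1 ≠ 0 := (ascPochhammer_pos n 1 one_pos).ne'
  have h2 : (1 + n : ℝ) ≠ 0 := by positivity
  have h3 : (n + 1 : ℝ) ≠ 0 := by positivity
  have h4 : (n ! : ℝ) ≠ 0 := by positivity
  simp only [quarterCoeff, ordinaryHypergeometricCoefficient, ascPochhammer_succ_eval,
    Nat.factorial_succ, Nat.cast_mul, Nat.cast_add, Nat.cast_one]
  field_simp
  ring

lemma quarterCoeff_pos (n : ℕ) : 0 < quarterCoeff n := by
  induction n with
  | zero => simp [quarterCoeff, ordinaryHypergeometricCoefficient]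
  | succ n ih => rw [quarterCoeff_succ]; positivity

lemma choose_neg_half_succ (n : ℕ) :
    Ring.choose (-1 / 2 : ℝ) (n + 1) = (-1 / 2 - n) / (n + 1) * Ring.choose (-1 / 2 : ℝ) n := by
  have h1 := Ring.descPochhammer_eq_factorial_smul_choose (-1 / 2 : ℝ) (n + 1)
  have h2 := Ring.descPochhammer_eq_factorial_smul_choose (-1 / 2 : ℝ) n
  simp only [descPochhammer_succ_right, Polynomial.smeval_mul, h2, Polynomial.smeval_sub,
    Polynomial.smeval_X, Polynomial.smeval_natCast, nsmul_eq_mul, Nat.factorial_succ,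
    Nat.cast_mul, Nat.cast_add, Nat.cast_one, pow_one, pow_zero, mul_one] at h1
  have h4 : (n ! : ℝ) ≠ 0 := by positivity
  have h3 : (n + 1 : ℝ) ≠ 0 := by positivity
  rw [div_mul_eq_mul_div, eq_div_iff h3]
  exact mul_left_cancel₀ h4 (by linear_combination -h1)

lemma integral_cos_two_mul_pow_succ_succ (n : ℕ) :
    ∫ θ in (-(π / 2))..(π / 2), cos (2 * θ) ^ (n + 2) =
      (n + 1) / (n + 2) * ∫ θ in (-(π / 2))..(π / 2), cos (2 * θ) ^ n := by
  have h (m : ℕ) := intervalIntegral.integral_comp_mul_left (a := -(π / 2)) (b := π / 2)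
    (fun x ↦ cos x ^ m) (two_ne_zero' ℝ)
  rw [h, h, integral_cos_pow]
  have e1 : 2 * (-(π / 2)) = -π := by ring
  have e2 : 2 * (π / 2) = π := by ring
  simp only [e1, e2, sin_neg, sin_pi, smul_eq_mul]
  ring

lemma integral_cos_two_mul_pow_odd (m : ℕ) :
    ∫ θ in (-(π / 2))..(π / 2), cos (2 * θ) ^ (2 * m + 1) = 0 := by
  induction m with
  | zero =>
    simp [intervalIntegral.integral_comp_mul_left (fun x ↦ cos x) (two_ne_zero' ℝ), mul_div_cancel₀]
  | succ m ih =>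
    rw [show 2 * (m + 1) + 1 = 2 * m + 1 + 2 by ring, integral_cos_two_mul_pow_succ_succ, ih,
      mul_zero]

/-- Both sides gain the factor $(m+\tfrac14)(m+\tfrac34)/(m+1)^2$ when $m$ grows by one. This is
where the parameters $\tfrac14,\tfrac34$ come from. -/
lemma choose_mul_integral_cos_two_mul_pow_even (m : ℕ) :
    Ring.choose (-1 / 2 : ℝ) (2 * m) * ∫ θ in (-(π / 2))..(π / 2), cos (2 * θ) ^ (2 * m) =
      π * quarterCoeff m := by
  induction m with
  | zero => simp [quarterCoeff, ordinaryHypergeometricCoefficient]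
  | succ m ih =>
    have h1 : (2 * (m : ℝ) + 1) ≠ 0 := by positivity
    have h2 : (2 * (m : ℝ) + 2) ≠ 0 := by positivity
    have h3 : (m : ℝ) + 1 ≠ 0 := by positivity
    have h5 : (2 * (m : ℝ) + 1 + 1) ≠ 0 := by positivity
    rw [show 2 * (m + 1) = 2 * m + 1 + 1 by ring, choose_neg_half_succ, choose_neg_half_succ,
      integral_cos_two_mul_pow_succ_succ, quarterCoeff_succ]
    push_cast
    rw [show ∀ a b c d e : ℝ, a * (b * c) * (d * e) = a * b * d * (c * e) by intros; ring, ih]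
    field_simp
    ring

lemma hasSum_one_add_rpow {x : ℝ} (hx : |x| < 1) :
    HasSum (fun n ↦ Ring.choose (-1 / 2 : ℝ) n * x ^ n) (1 / √(1 + x)) := by
  have h := (one_add_rpow_hasFPowerSeriesOnBall_zero (a := (-1 / 2 : ℝ))).hasSum
    (y := x) (by simpa [enorm_eq_nnnorm, ← NNReal.coe_lt_one] using hx)
  have h1 : 0 < 1 + x := by linarith [neg_abs_le x]
  rw [zero_add, show (-1 / 2 : ℝ) = -(1 / 2) by norm_num, rpow_neg h1.le, ← sqrt_eq_rpow] at h
  rw [one_div, show (-1 / 2 : ℝ) = -(1 / 2) by norm_num]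
  simpa only [binomialSeries_apply, List.ofFn_const, List.prod_replicate, smul_eq_mul] using h

/-- `E(1 + κ, 1 - κ) = π F(1/4, 3/4; 1; κ²)`, as the sum of a series. -/
lemma hasSum_ellipticIntegral {κ : ℝ} (h0 : 0 ≤ κ) (h1 : κ < 1) :
    HasSum (fun m ↦ π * (quarterCoeff m * (κ ^ 2) ^ m)) (ellipticIntegral (1 + κ) (1 - κ)) := by
  have hb (θ : ℝ) : |κ * cos (2 * θ)| ≤ κ := by
    rw [abs_mul, abs_of_nonneg h0]
    exact mul_le_of_le_one_right h0 (abs_cos_le_one _)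
  have hsum : HasSum (fun n ↦ ∫ θ in (-(π / 2))..(π / 2),
      Ring.choose (-1 / 2 : ℝ) n * (κ * cos (2 * θ)) ^ n)
      (∫ θ in (-(π / 2))..(π / 2), 1 / √(1 + κ * cos (2 * θ))) := by
    refine intervalIntegral.hasSum_integral_of_dominated_convergence
      (fun n _ ↦ ‖Ring.choose (-1 / 2 : ℝ) n * κ ^ n‖) (fun n ↦ ?_) (fun n ↦ ?_) ?_ ?_ ?_
    · exact Continuous.aestronglyMeasurable (by fun_prop)
    · refine Eventually.of_forall fun θ _ ↦ ?_
      rw [norm_mul, norm_mul, norm_pow, norm_pow]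
      gcongr
      simpa [abs_of_nonneg h0] using hb θ
    · refine Eventually.of_forall fun θ _ ↦ ?_
      exact (hasSum_one_add_rpow (by rwa [abs_of_nonneg h0])).summable.norm
    · exact intervalIntegrable_const
    · exact Eventually.of_forall fun θ _ ↦ hasSum_one_add_rpow ((hb θ).trans_lt h1)
  -- $(1+\kappa)\cos^2\theta+(1-\kappa)\sin^2\theta=1+\kappa\cos2\theta$.
  have hE : ellipticIntegral (1 + κ) (1 - κ) =
      ∫ θ in (-(π / 2))..(π / 2), 1 / √(1 + κ * cos (2 * θ)) := by
    rw [ellipticIntegral_eq_trig (by linarith) (by linarith)]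
    refine intervalIntegral.integral_congr fun θ _ ↦ ?_
    rw [cos_two_mul]
    congr 2
    linear_combination (1 - κ) * sin_sq_add_cos_sq θ
  rw [hE]
  have hinj : Function.Injective (fun m : ℕ ↦ 2 * m) := fun a b h ↦ by simpa using h
  have hcoef (n : ℕ) : ∫ θ in (-(π / 2))..(π / 2),
      Ring.choose (-1 / 2 : ℝ) n * (κ * cos (2 * θ)) ^ n =
      κ ^ n * (Ring.choose (-1 / 2 : ℝ) n * ∫ θ in (-(π / 2))..(π / 2), cos (2 * θ) ^ n) := by
    rw [← mul_assoc, ← intervalIntegral.integral_const_mul]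
    refine intervalIntegral.integral_congr fun θ _ ↦ ?_
    ring
  simp only [hcoef] at hsum
  -- Odd powers of $\cos2\theta$ integrate to zero, so only the indices $2m$ remain.
  rw [← hinj.hasSum_iff] at hsum
  · refine hsum.congr_fun fun m ↦ ?_
    simp only [Function.comp, choose_mul_integral_cos_two_mul_pow_even]
    ring
  · intro n hn
    obtain ⟨m, rfl | rfl⟩ := n.even_or_odd'
    · exact absurd ⟨m, rfl⟩ hn
    · simp [integral_cos_two_mul_pow_odd]

/-- Convergence is inherited from the series of the elliptic integral. -/
lemma hasSum_quarterCoeff {κ : ℝ} (h0 : 0 ≤ κ) (h1 : κ < 1) :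
    HasSum (fun m ↦ quarterCoeff m * (κ ^ 2) ^ m) (₂F₁ (1 / 4 : ℝ) (3 / 4 : ℝ) (1 : ℝ) (κ ^ 2)) := by
  have h := (hasSum_ellipticIntegral h0 h1).summable
  rw [summable_mul_left_iff pi_ne_zero] at h
  rw [ordinaryHypergeometric_eq_tsum]
  exact h.hasSum

/-- `E(1 + κ, 1 - κ) = π F(1/4, 3/4; 1; κ²)`. -/
lemma ellipticIntegral_eq_hypergeometric {κ : ℝ} (h0 : 0 ≤ κ) (h1 : κ < 1) :
    ellipticIntegral (1 + κ) (1 - κ) = π * ₂F₁ (1 / 4 : ℝ) (3 / 4 : ℝ) (1 : ℝ) (κ ^ 2) :=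
  (hasSum_ellipticIntegral h0 h1).unique ((hasSum_quarterCoeff h0 h1).mul_left π)

lemma hypergeometric_strictMono {x y : ℝ} (hx : 0 ≤ x) (hxy : x < y) (hy : y < 1) :
    ₂F₁ (1 / 4 : ℝ) (3 / 4 : ℝ) (1 : ℝ) x < ₂F₁ (1 / 4 : ℝ) (3 / 4 : ℝ) (1 : ℝ) y := by
  have hs {z : ℝ} (h0 : 0 ≤ z) (h1 : z < 1) := hasSum_quarterCoeff (sqrt_nonneg z)
    (by rwa [sqrt_lt' one_pos, one_pow])
  have h1 := hs hx (hxy.trans hy)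
  have h2 := hs (hx.trans hxy.le) hy
  rw [sq_sqrt hx] at h1
  rw [sq_sqrt (hx.trans hxy.le)] at h2
  refine hasSum_lt (i := 1) (fun n ↦ ?_) ?_ h1 h2
  · have := (quarterCoeff_pos n).le
    simp only
    gcongr
  · have := quarterCoeff_pos 1
    simp only [pow_one]
    gcongr

lemma hypergeometric_pos {x : ℝ} (hx : 0 < x) (hx1 : x < 1) :
    0 < ₂F₁ (1 / 4 : ℝ) (3 / 4 : ℝ) (1 : ℝ) x := by
  have := hypergeometric_strictMono le_rfl hx hx1
  rw [ordinaryHypergeometric_zero] at this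
  linarith

end Hypergeometric

/-! ### Uniqueness for analytic solutions of linear equations at a point. -/

section AnalyticODE

open Filter Topology

/-- A solution of `z D' = k D` with `k(0) ∉ ℕ`, analytic at `0`, vanishes near `0`. -/
lemma AnalyticAt.eventuallyEq_zero_of_mul_deriv_eq {D k : ℂ → ℂ} {k₀ : ℂ}
    (hD : AnalyticAt ℂ D 0) (hk : Tendsto k (𝓝[≠] 0) (𝓝 k₀)) (hk₀ : ∀ n : ℕ, k₀ ≠ n)
    (h : ∀ᶠ z in 𝓝[≠] 0, z * deriv D z = k z * D z) : ∀ᶠ z in 𝓝 0, D z = 0 := by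
  by_contra hne
  obtain ⟨n, g, hg, hg0, hgD⟩ := hD.exists_eventuallyEq_pow_smul_nonzero_iff.2 hne
  -- With $D=z^ng$, $g(0)\ne0$, cancel $z^n$; letting $z\to0$ then gives $n=k_0$.
  have h1 : ∀ᶠ z in 𝓝[≠] (0 : ℂ), n * g z + z * deriv g z = k z * g z := by
    filter_upwards [h, hgD.eventually_nhds.filter_mono nhdsWithin_le_nhds,
      hg.eventually_analyticAt.filter_mono nhdsWithin_le_nhds, self_mem_nhdsWithin]
      with z hz hDz hgz hz0
    have hz0 : z ≠ 0 := hz0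
    have hd : HasDerivAt (fun z : ℂ ↦ z ^ n * g z)
        (n * z ^ (n - 1) * g z + z ^ n * deriv g z) z :=
      (hasDerivAt_pow n z).mul hgz.differentiableAt.hasDerivAt
    have hD' : D =ᶠ[𝓝 z] fun z ↦ z ^ n * g z := by
      simpa [EventuallyEq] using hDz
    rw [hD'.deriv_eq, hd.deriv, hD'.eq_of_nhds] at hz
    have hp : z * (n * z ^ (n - 1)) = n * z ^ n := by
      cases n with
      | zero => simp
      | succ n => simp only [add_tsub_cancel_right]; ring
    refine mul_left_cancel₀ (pow_ne_zero n hz0) ?_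
    linear_combination hz - g z * hp
  have hgc : Tendsto g (𝓝[≠] 0) (𝓝 (g 0)) := hg.continuousAt.tendsto.mono_left nhdsWithin_le_nhds
  have hgc' : Tendsto (deriv g) (𝓝[≠] 0) (𝓝 (deriv g 0)) :=
    hg.deriv.continuousAt.tendsto.mono_left nhdsWithin_le_nhds
  have hid : Tendsto (fun z : ℂ ↦ z) (𝓝[≠] 0) (𝓝 0) := tendsto_id.mono_left nhdsWithin_le_nhds
  have h2 := tendsto_nhds_unique ((((hgc.const_mul (n : ℂ)).add (hid.mul hgc'))).congr' h1)
    (hk.mul hgc)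
  rw [zero_mul, add_zero] at h2
  exact hk₀ n (mul_right_cancel₀ hg0 h2).symm

/-- A solution of `D'' = K D` with `D(0) = D'(0) = 0`, analytic at `0`, vanishes near `0`. -/
lemma AnalyticAt.eventuallyEq_zero_of_deriv_deriv_eq {D K : ℂ → ℂ}
    (hD : AnalyticAt ℂ D 0) (hK : AnalyticAt ℂ K 0) (h0 : D 0 = 0) (h0' : deriv D 0 = 0)
    (h : ∀ᶠ z in 𝓝 0, deriv (deriv D) z = K z * D z) : ∀ᶠ z in 𝓝 0, D z = 0 := by
  have e1 := hD.analyticOrderAt_deriv_add_one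
  have e2 := hD.deriv.analyticOrderAt_deriv_add_one
  simp only [h0, h0', sub_zero] at e1 e2
  -- Two derivatives lower a finite order by 2, while multiplying by $K$ cannot lower it; so the
  -- order of $D$ is infinite.
  have e3 : analyticOrderAt (deriv (deriv D)) 0 = analyticOrderAt K 0 + analyticOrderAt D 0 := by
    rw [← analyticOrderAt_mul hK hD]
    exact analyticOrderAt_congr h
  rw [← analyticOrderAt_eq_top]
  rw [← e2, e3] at e1
  by_contra hne
  obtain ⟨n, hn⟩ := ENat.ne_top_iff_exists.1 hne
  change analyticOrderAt K 0 + analyticOrderAt D 0 + 1 + 1 = analyticOrderAt D 0 at e1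
  rw [← hn] at e1
  cases hk : analyticOrderAt K 0 with
  | top => rw [hk] at e1; simp at e1
  | coe m =>
    rw [hk] at e1
    norm_cast at e1
    omega

end AnalyticODE

/-! ### ℘ is determined by its invariants; its periods and half-periods. -/

namespace PeriodPair

open Filter Topology Bornology Set

variable (L M : PeriodPair)

lemma countable_lattice : (L.lattice : Set ℂ).Countable :=
  Set.countable_coe_iff.1 (L.latticeEquivProd.toEquiv.countable_iff.2 inferInstance)

lemma eventually_notMem_lattice (w : ℂ) : ∀ᶠ z in 𝓝[≠] w, z ∉ L.lattice := by
  filter_upwards [self_mem_nhdsWithin,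
    mem_nhdsWithin_of_mem_nhds (L.compl_lattice_sdiff_singleton_mem_nhds w)] with z hz hz' h
  exact hz' ⟨h, hz⟩

lemma tendsto_add_const_nhdsNE (w a : ℂ) : Tendsto (· + a) (𝓝[≠] w) (𝓝[≠] (w + a)) :=
  tendsto_nhdsWithin_of_tendsto_nhds_of_eventually_within _
    ((continuous_add_const a).tendsto w |>.mono_left nhdsWithin_le_nhds)
    (by filter_upwards [self_mem_nhdsWithin] with z hz; simpa using hz)

lemma tendsto_weierstrassP_cobounded {l : ℂ} (hl : l ∈ L.lattice) :
    Tendsto ℘[L] (𝓝[≠] l) (cobounded ℂ) :=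
  tendsto_cobounded_of_meromorphicOrderAt_neg (by rw [L.order_weierstrassP l hl]; decide)

/-- The identity theorem for translates of `℘`-functions: equality near a point forces the
translated poles to agree. -/
lemma mem_lattice_of_eventually_eq {L M : PeriodPair} {a b z₀ : ℂ}
    (h : ∀ᶠ z in 𝓝[≠] z₀, ℘[L] (z + a) = ℘[M] (z + b)) {l : ℂ} (hl : l ∈ L.lattice) :
    l - a + b ∈ M.lattice := by
  set S : Set ℂ := (· + a) ⁻¹' L.lattice ∪ (· + b) ⁻¹' M.lattice
  have hS : S.Countable := (L.countable_lattice.preimage (add_left_injective a)).union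
    (M.countable_lattice.preimage (add_left_injective b))
  -- The poles are countable, so their complement in the plane is connected.
  have hU : IsPreconnected Sᶜ := (hS.isConnected_compl_of_one_lt_rank (by simp)).isPreconnected
  have hev (w : ℂ) : ∀ᶠ z in 𝓝[≠] w, z ∈ Sᶜ := by
    filter_upwards [(tendsto_add_const_nhdsNE w a).eventually (L.eventually_notMem_lattice _),
      (tendsto_add_const_nhdsNE w b).eventually (M.eventually_notMem_lattice _)] with z h1 h2
    rintro (h | h)
    exacts [h1 h, h2 h]
  obtain ⟨z₁, hz₁, hz₁S⟩ := ((eventually_eventually_nhdsWithin.2 h).and (hev z₀)).exists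
  have hnb : {z₀}ᶜ ∈ 𝓝 z₁ ∨ z₁ = z₀ := by
    by_cases hz : z₁ = z₀
    · exact .inr hz
    · exact .inl (isOpen_compl_singleton.mem_nhds hz)
  have hfreq : ∃ᶠ z in 𝓝[≠] z₁, ℘[L] (z + a) = ℘[M] (z + b) := by
    rcases hnb with hnb | rfl
    · rw [nhdsWithin_eq_nhds.2 hnb] at hz₁
      exact (hz₁.filter_mono nhdsWithin_le_nhds).frequently
    · exact h.frequently
  have hEq : EqOn (fun z ↦ ℘[L] (z + a)) (fun z ↦ ℘[M] (z + b)) Sᶜ := by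
    refine AnalyticOnNhd.eqOn_of_preconnected_of_frequently_eq (𝕜 := ℂ) ?_ ?_ hU hz₁S hfreq
    · intro z hz
      exact (L.analyticOnNhd_weierstrassP (z + a) fun h ↦ hz (.inl h)).comp
        (f := fun z ↦ z + a) (by fun_prop)
    · intro z hz
      exact (M.analyticOnNhd_weierstrassP (z + b) fun h ↦ hz (.inr h)).comp
        (f := fun z ↦ z + b) (by fun_prop)
  -- Otherwise the left side has a pole at $l-a$ where the right side is continuous.
  by_contra hb
  have t1 : Tendsto (fun z ↦ ℘[L] (z + a)) (𝓝[≠] (l - a)) (cobounded ℂ) := by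
    have := L.tendsto_weierstrassP_cobounded hl
    have h2 := tendsto_add_const_nhdsNE (l - a) a
    rw [sub_add_cancel] at h2
    exact this.comp h2
  have t2 : Tendsto (fun z ↦ ℘[M] (z + b)) (𝓝[≠] (l - a)) (𝓝 (℘[M] (l - a + b))) :=
    ((M.analyticOnNhd_weierstrassP _ hb).continuousAt.tendsto.comp
      ((continuous_add_const b).tendsto (l - a))).mono_left nhdsWithin_le_nhds
  refine (t2.congr' ?_).not_tendsto (Metric.disjoint_nhds_cobounded _) t1
  filter_upwards [hev (l - a)] with z hz using (hEq hz).symm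

lemma hasDerivAt_weierstrassP {z : ℂ} (hz : z ∉ L.lattice) : HasDerivAt ℘[L] (℘'[L] z) z := by
  rw [← L.deriv_weierstrassP]
  exact (L.analyticOnNhd_weierstrassP z hz).differentiableAt.hasDerivAt

/-- Differentiating $\wp'^2=4\wp^3-g_2\wp-g_3$ gives this identity multiplied by $\wp'$. On the
connected complement of the lattice one factor vanishes identically, and it is not $\wp'$: a
constant has no pole at 0. -/
lemma deriv_derivWeierstrassP {z : ℂ} (hz : z ∉ L.lattice) :
    deriv ℘'[L] z = 6 * ℘[L] z ^ 2 - L.g₂ / 2 := by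
  have hconn : IsPreconnected (L.lattice : Set ℂ)ᶜ :=
    (L.countable_lattice.isConnected_compl_of_one_lt_rank (by simp)).isPreconnected
  have hX : AnalyticOnNhd ℂ (fun z ↦ 2 * deriv ℘'[L] z - 12 * ℘[L] z ^ 2 + L.g₂)
      (L.lattice : Set ℂ)ᶜ := fun w hw ↦ by
    have h1 := (L.analyticOnNhd_derivWeierstrassP w hw).deriv
    have h2 := L.analyticOnNhd_weierstrassP w hw
    fun_prop
  have hmul : ∀ w ∈ (L.lattice : Set ℂ)ᶜ,
      ℘'[L] w * (2 * deriv ℘'[L] w - 12 * ℘[L] w ^ 2 + L.g₂) = 0 := by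
    intro w hw
    have hd := (L.analyticOnNhd_derivWeierstrassP w hw).differentiableAt.hasDerivAt
    have hp := L.hasDerivAt_weierstrassP hw
    have e : (fun z ↦ ℘'[L] z ^ 2) =ᶠ[𝓝 w] fun z ↦ 4 * ℘[L] z ^ 3 - L.g₂ * ℘[L] z - L.g₃ := by
      filter_upwards [L.isClosed_lattice.isOpen_compl.mem_nhds hw] with z hz
      exact L.derivWeierstrassP_sq z hz
    have h1 := (hd.pow 2).deriv
    have h2 := ((((hp.pow 3).const_mul 4).sub (hp.const_mul L.g₂)).sub_const L.g₃).deriv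
    have h3 := e.deriv_eq
    change deriv (fun z ↦ ℘'[L] z ^ 2) w = _ at h1
    change deriv (fun z ↦ 4 * ℘[L] z ^ 3 - L.g₂ * ℘[L] z - L.g₃) w = _ at h2
    rw [h1, h2] at h3
    simp at h3
    linear_combination h3
  rcases (L.analyticOnNhd_derivWeierstrassP.eq_zero_or_eq_zero_of_mul_eq_zero hX hmul hconn)
    with h | h
  · exfalso
    have hL0 := L.ω₁_div_two_notMem_lattice
    have hconst : ∀ w ∈ (L.lattice : Set ℂ)ᶜ, ℘[L] w = ℘[L] (L.ω₁ / 2) := fun w hw ↦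
      L.isClosed_lattice.isOpen_compl.is_const_of_deriv_eq_zero hconn
        L.differentiableOn_weierstrassP
        (fun z hz ↦ by rw [L.deriv_weierstrassP]; exact h z hz) hw hL0
    have t : Tendsto ℘[L] (𝓝[≠] 0) (𝓝 (℘[L] (L.ω₁ / 2))) :=
      tendsto_const_nhds.congr' (by
        filter_upwards [L.eventually_notMem_lattice 0] with z hz using (hconst z hz).symm)
    exact t.not_tendsto (Metric.disjoint_nhds_cobounded _)
      (L.tendsto_weierstrassP_cobounded (zero_mem _))
  · linear_combination (1 / 2) * h z hz

/-- `℘` and `℘'` together separate points modulo the lattice. -/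
lemma sub_mem_lattice_of_eq {a b : ℂ} (ha : a ∉ L.lattice) (hb : b ∉ L.lattice)
    (h : ℘[L] a = ℘[L] b) (h' : ℘'[L] a = ℘'[L] b) : b - a ∈ L.lattice := by
  have hP {c : ℂ} (hc : c ∉ L.lattice) : AnalyticAt ℂ (fun z ↦ ℘[L] (z + c)) 0 :=
    AnalyticAt.comp (g := ℘[L]) (f := fun z ↦ z + c)
      (L.analyticOnNhd_weierstrassP _ (by simpa using hc)) (by fun_prop)
  have hev {c : ℂ} (hc : c ∉ L.lattice) : ∀ᶠ z in 𝓝 0, z + c ∉ L.lattice := by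
    have := (continuous_add_const c).tendsto 0
    rw [zero_add] at this
    exact this.eventually (L.isClosed_lattice.isOpen_compl.mem_nhds hc)
  have hd {c : ℂ} {z : ℂ} (hz : z + c ∉ L.lattice) :
      HasDerivAt (fun z ↦ ℘[L] (z + c)) (℘'[L] (z + c)) z :=
    (L.hasDerivAt_weierstrassP hz).comp_add_const z c
  have hdd {c : ℂ} {z : ℂ} (hz : z + c ∉ L.lattice) :
      HasDerivAt (fun z ↦ ℘'[L] (z + c)) (6 * ℘[L] (z + c) ^ 2 - L.g₂ / 2) z := by
    rw [← L.deriv_derivWeierstrassP hz]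
    exact (L.analyticOnNhd_derivWeierstrassP _ hz).differentiableAt.hasDerivAt.comp_add_const z c
  have hD1 : ∀ᶠ z in 𝓝 0, deriv (fun z ↦ ℘[L] (z + a) - ℘[L] (z + b)) z =
      ℘'[L] (z + a) - ℘'[L] (z + b) := by
    filter_upwards [hev ha, hev hb] with z hza hzb using ((hd hza).sub (hd hzb)).deriv
  -- The difference of the two translates satisfies $D''=6(\wp(z+a)+\wp(z+b))D$ with $D(0)=D'(0)=0$,
  -- so the translates coincide.
  have key := AnalyticAt.eventuallyEq_zero_of_deriv_deriv_eq (D := fun z ↦ ℘[L] (z + a) - ℘[L] (z + b))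
    (K := fun z ↦ 6 * (℘[L] (z + a) + ℘[L] (z + b))) ((hP ha).sub (hP hb))
    (by have h1 := hP ha; have h2 := hP hb; fun_prop) (by simp [h])
    (by rw [hD1.self_of_nhds]; simp [h']) (by
      filter_upwards [hD1.eventually_nhds, hev ha, hev hb] with z hz hza hzb
      rw [EventuallyEq.deriv_eq hz]
      refine ((hdd hza).sub (hdd hzb)).deriv.trans ?_
      ring)
  have := mem_lattice_of_eventually_eq (L := L) (M := L) (a := a) (b := b) (z₀ := 0)
    ((key.filter_mono nhdsWithin_le_nhds).mono fun z hz ↦ sub_eq_zero.1 hz) (zero_mem _)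
  rwa [zero_sub, neg_add_eq_sub] at this

lemma derivWeierstrassP_eq_zero_of_two_mul_mem {z : ℂ} (hz : 2 * z ∈ L.lattice) :
    ℘'[L] z = 0 := by
  have h := L.derivWeierstrassP_sub_coe z ⟨2 * z, hz⟩
  rw [show z - 2 * z = -z by ring, L.derivWeierstrassP_neg] at h
  exact CharZero.eq_neg_self_iff.1 h.symm

lemma two_mul_mem_of_derivWeierstrassP_eq_zero {z : ℂ} (hz : z ∉ L.lattice) (h : ℘'[L] z = 0) :
    2 * z ∈ L.lattice := by
  have := L.sub_mem_lattice_of_eq (a := -z) (b := z) (by simpa using hz) hz (by simp) (by simp [h])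
  rwa [sub_neg_eq_add, ← two_mul] at this

/-- `℘` has distinct values at inequivalent half-periods. -/
lemma sub_mem_lattice_of_half_periods {a b : ℂ} (ha : a ∉ L.lattice) (hb : b ∉ L.lattice)
    (ha2 : 2 * a ∈ L.lattice) (hb2 : 2 * b ∈ L.lattice) (h : ℘[L] a = ℘[L] b) :
    b - a ∈ L.lattice :=
  L.sub_mem_lattice_of_eq ha hb h (by
    rw [L.derivWeierstrassP_eq_zero_of_two_mul_mem ha2,
      L.derivWeierstrassP_eq_zero_of_two_mul_mem hb2])

/-- Both functions have principal part $z^{-2}$, so their difference $D$ is analytic at 0.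
Subtracting the two differential equations gives $zD'=(\mathrm{num}/\mathrm{den})D$ with
$\mathrm{num}/\mathrm{den}\to12/(-4)=-3$. As $-3$ is not a possible order of vanishing, $D=0$ near
0, and the poles agree. -/
lemma lattice_le_of_g_eq {L M : PeriodPair} (h2 : L.g₂ = M.g₂) (h3 : L.g₃ = M.g₃) :
    L.lattice ≤ M.lattice := by
  set p := L.weierstrassPExcept 0
  set q := M.weierstrassPExcept 0
  set p' := L.derivWeierstrassPExcept 0
  set q' := M.derivWeierstrassPExcept 0
  have ap : AnalyticAt ℂ p 0 := L.analyticAt_weierstrassPExcept 0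
  have aq : AnalyticAt ℂ q 0 := M.analyticAt_weierstrassPExcept 0
  have ap' : AnalyticAt ℂ p' 0 := L.analyticAt_derivWeierstrassPExcept 0
  have aq' : AnalyticAt ℂ q' 0 := M.analyticAt_derivWeierstrassPExcept 0
  have ep (N : PeriodPair) (z : ℂ) : ℘[N] z = N.weierstrassPExcept 0 z + 1 / z ^ 2 := by
    have := N.weierstrassPExcept_add 0 z
    simp at this
    simp [this]
  have ep' (N : PeriodPair) (z : ℂ) : ℘'[N] z = N.derivWeierstrassPExcept 0 z - 2 / z ^ 3 := by
    have := N.derivWeierstrassPExcept_sub 0 z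
    simp at this
    simp [this]
  set num : ℂ → ℂ := fun z ↦ 4 * ((z ^ 2 * p z + 1) ^ 2 + (z ^ 2 * p z + 1) * (z ^ 2 * q z + 1) +
    (z ^ 2 * q z + 1) ^ 2) - L.g₂ * z ^ 4
  set den : ℂ → ℂ := fun z ↦ z ^ 3 * (p' z + q' z) - 4
  have hnum : AnalyticAt ℂ num 0 := by simp only [num]; fun_prop
  have hden : AnalyticAt ℂ den 0 := by simp only [den]; fun_prop
  have hden0 : den 0 = -4 := by simp [den]
  have hnum0 : num 0 = 12 := by simp [num]; norm_num
  have hk : Tendsto (fun z ↦ num z / den z) (𝓝[≠] 0) (𝓝 (-3)) := by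
    have := (hnum.continuousAt.tendsto.div hden.continuousAt.tendsto
      (by rw [hden0]; norm_num)).mono_left (nhdsWithin_le_nhds (s := {0}ᶜ))
    rw [hden0, hnum0] at this
    rwa [show (12 : ℂ) / -4 = -3 by norm_num] at this
  have hdenev : ∀ᶠ z in 𝓝[≠] 0, den z ≠ 0 :=
    (hden.continuousAt.eventually_ne (by rw [hden0]; norm_num)).filter_mono nhdsWithin_le_nhds
  have hd (N : PeriodPair) : ∀ᶠ z in 𝓝[≠] 0, HasDerivAt (N.weierstrassPExcept 0) (N.derivWeierstrassPExcept 0 z) z := by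
    filter_upwards [N.eventually_notMem_lattice 0] with z hz
    rw [← N.eqOn_deriv_weierstrassPExcept_derivWeierstrassPExcept 0 (fun h ↦ hz h.1)]
    exact (N.analyticOnNhd_weierstrassPExcept 0 z fun h ↦ hz h.1).differentiableAt.hasDerivAt
  have key := AnalyticAt.eventuallyEq_zero_of_mul_deriv_eq (D := fun z ↦ p z - q z)
    (ap.sub aq) hk (fun n h ↦ by
      have := congrArg Complex.re h
      simp at this
      linarith [n.cast_nonneg (α := ℝ)]) (by
      filter_upwards [hd L, hd M, hdenev, L.eventually_notMem_lattice 0,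
        M.eventually_notMem_lattice 0, self_mem_nhdsWithin] with z h1 h2' h4 hL hM hz
      have hz : z ≠ 0 := hz
      have hder : deriv (fun z ↦ p z - q z) z = p' z - q' z := (h1.sub h2').deriv
      rw [hder, div_mul_eq_mul_div, eq_div_iff h4]
      have eL : (p' z - 2 / z ^ 3) ^ 2 =
          4 * (p z + 1 / z ^ 2) ^ 3 - L.g₂ * (p z + 1 / z ^ 2) - L.g₃ := by
        have := L.derivWeierstrassP_sq z hL
        rwa [ep, ep'] at this
      have eM : (q' z - 2 / z ^ 3) ^ 2 =
          4 * (q z + 1 / z ^ 2) ^ 3 - L.g₂ * (q z + 1 / z ^ 2) - L.g₃ := by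
        have := M.derivWeierstrassP_sq z hM
        rwa [ep, ep', ← h2, ← h3] at this
      have e : ((p' z - 2 / z ^ 3) ^ 2 - (q' z - 2 / z ^ 3) ^ 2) * z ^ 4 =
        (4 * (p z + 1 / z ^ 2) ^ 3 - L.g₂ * (p z + 1 / z ^ 2) -
        (4 * (q z + 1 / z ^ 2) ^ 3 - L.g₂ * (q z + 1 / z ^ 2))) * z ^ 4 := by
        linear_combination z ^ 4 * eL - z ^ 4 * eM
      simp only [num, den]
      have e1 : ((p' z - 2 / z ^ 3) ^ 2 - (q' z - 2 / z ^ 3) ^ 2) * z ^ 4 =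
        z * (p' z - q' z) * (z ^ 3 * (p' z + q' z) - 4) := by field_simp; ring
      rw [← e1, e]
      field_simp
      ring)
  intro l hl
  have := mem_lattice_of_eventually_eq (L := L) (M := M) (a := 0) (b := 0) (z₀ := 0)
    ((key.filter_mono nhdsWithin_le_nhds).mono fun z hz ↦ by
      simp only [add_zero, ep L z, ep M z]
      exact congrArg (· + 1 / z ^ 2) (sub_eq_zero.1 hz)) hl
  simpa using this

/-- The function `℘` is determined by its invariants. -/
lemma lattice_eq_of_g_eq {L M : PeriodPair} (h2 : L.g₂ = M.g₂) (h3 : L.g₃ = M.g₃) :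
    L.lattice = M.lattice :=
  le_antisymm (lattice_le_of_g_eq h2 h3) (lattice_le_of_g_eq h2.symm h3.symm)

lemma weierstrassP_eq_of_lattice_eq {L M : PeriodPair} (h : L.lattice = M.lattice) :
    ℘[L] = ℘[M] := by
  ext z
  simp only [weierstrassP]
  rw [h]

/-- The periods of `℘` are exactly the lattice points. -/
lemma periodic_weierstrassP_iff (w : ℂ) : Function.Periodic ℘[L] w ↔ w ∈ L.lattice := by
  refine ⟨fun h ↦ ?_, fun h ↦ L.periodic_weierstrassP ⟨w, h⟩⟩
  have := mem_lattice_of_eventually_eq (L := L) (M := L) (a := 0) (b := w) (z₀ := 0)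
    (Eventually.of_forall fun z ↦ by simpa using (h z).symm) (zero_mem _)
  simpa using this

end PeriodPair

/-! ### Rectangular lattices and their periods as elliptic integrals. -/

namespace PeriodPair

open Filter Topology Set
open scoped ComplexConjugate

/-- On a ray `x c` with `c²` real on which `℘` is real, the half period and the values of `℘` at the
half-periods are related by a complete elliptic integral. -/
lemma real_ray (L : PeriodPair) {c : ℂ} {σ T e₁ e₂ e₃ : ℝ} (hT : 0 < T)
    (hc : c ^ 2 = σ) (hσ : σ ≠ 0)
    (hmem : ∀ x : ℝ, (x * c : ℂ) ∈ L.lattice → ∃ n : ℤ, x = 2 * n * T)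
    (hmem' : 2 * (T * c : ℂ) ∈ L.lattice)
    (hreal : ∀ x : ℝ, (℘[L] (x * c)).im = 0)
    (he : ℘[L] (T * c) = e₁) (h12 : e₁ ≠ e₂) (h13 : e₁ ≠ e₃)
    (hcubic : ∀ x : ℂ, 4 * x ^ 3 - L.g₂ * x - L.g₃ = 4 * (x - e₁) * (x - e₂) * (x - e₃)) :
    σ * e₂ < σ * e₁ ∧ σ * e₃ < σ * e₁ ∧
      T = ellipticIntegral (σ * e₁ - σ * e₂) (σ * e₁ - σ * e₃) / 2 := by
  have hc0 : c ≠ 0 := by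
    rintro rfl
    have : σ = 0 := by exact_mod_cast (by simpa using hc.symm : (σ : ℂ) = 0)
    exact hσ this
  have hnot : ∀ x : ℝ, 0 < x → x < 2 * T → (x * c : ℂ) ∉ L.lattice := by
    intro x h0 h1 h
    obtain ⟨n, rfl⟩ := hmem x h
    have h2 : 0 < (n : ℝ) := by
      by_contra hn
      have := mul_nonneg (neg_nonneg.2 (not_lt.1 hn)) hT.le
      linarith
    have h3 : (n : ℝ) < 1 := by
      by_contra hn
      have := mul_le_mul_of_nonneg_right (not_lt.1 hn) hT.le
      linarith
    norm_cast at h2 h3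
    omega
  have hnot' : ∀ x : ℝ, x ∈ Ioc 0 T → (x * c : ℂ) ∉ L.lattice := fun x hx ↦
    hnot x hx.1 (by linarith [hx.2])
  set f : ℝ → ℝ := fun x ↦ (c ^ 2 * ℘[L] (x * c)).re
  set f' : ℝ → ℝ := fun x ↦ (c ^ 3 * ℘'[L] (x * c)).re
  have hf : ∀ x : ℝ, c ^ 2 * ℘[L] (x * c) = (f x : ℂ) := fun x ↦ by
    apply Complex.ext
    · simp [f]
    · rw [hc, Complex.im_ofReal_mul, hreal, mul_zero, Complex.ofReal_im]
  have hF : ∀ x ∈ Ioc 0 T, HasDerivAt (fun x : ℝ ↦ c ^ 2 * ℘[L] (x * c))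
      (c ^ 3 * ℘'[L] (x * c)) x := by
    intro x hx
    have h1 : HasDerivAt (fun z : ℂ ↦ z * c) c x := by
      simpa using (hasDerivAt_id (x : ℂ)).mul_const c
    have h2 := ((L.hasDerivAt_weierstrassP (hnot' x hx)).comp (x : ℂ) h1).const_mul (c ^ 2)
    exact (h2.comp_ofReal).congr_deriv (by ring)
  have hf' : ∀ x ∈ Ioc 0 T, c ^ 3 * ℘'[L] (x * c) = (f' x : ℂ) := by
    intro x hx
    apply Complex.ext
    · simp [f']
    · have h1 := (Complex.imCLM.hasFDerivAt.comp_hasDerivAt x (hF x hx)).deriv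
      have h2 : (Complex.imCLM ∘ fun x : ℝ ↦ c ^ 2 * ℘[L] (x * c)) = fun _ ↦ 0 := by
        ext y
        simp only [Function.comp, hf, Complex.imCLM_apply, Complex.ofReal_im]
      rw [h2, deriv_const] at h1
      rw [Complex.ofReal_im]
      exact h1.symm
  have hfd : ∀ x ∈ Ioc 0 T, HasDerivAt f (f' x) x := fun x hx ↦
    Complex.reCLM.hasFDerivAt.comp_hasDerivAt x (hF x hx)
  have hode : ∀ x ∈ Ioc 0 T,
      f' x ^ 2 = 4 * (f x - σ * e₂) * (f x - σ * e₃) * (f x - σ * e₁) := by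
    intro x hx
    have h := L.derivWeierstrassP_sq _ (hnot' x hx)
    rw [hcubic] at h
    have : ((f' x : ℂ)) ^ 2 = 4 * (f x - σ * e₂) * (f x - σ * e₃) * (f x - σ * e₁) := by
      rw [← hf' x hx, ← hf x, ← hc]
      linear_combination c ^ 6 * h
    exact_mod_cast this
  -- Equal values of $\wp$ give $\wp'$ equal up to sign, so $(x-y)c$ or $(x+y)c$ is a lattice point;
  -- for $x\ne y$ the gap up to $2T$ excludes both.
  have hinj : InjOn f (Ioc 0 T) := by
    intro x hx y hy hxy
    have h1 : ℘[L] (x * c) = ℘[L] (y * c) := by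
      have := (hf x).trans ((congrArg _ hxy).trans (hf y).symm)
      exact mul_left_cancel₀ (pow_ne_zero 2 hc0) this
    have h2 : ℘'[L] (x * c) ^ 2 = ℘'[L] (y * c) ^ 2 := by
      rw [L.derivWeierstrassP_sq _ (hnot' x hx), L.derivWeierstrassP_sq _ (hnot' y hy), h1]
    rcases sq_eq_sq_iff_eq_or_eq_neg.1 h2 with h2 | h2
    · by_contra hne
      rcases lt_or_gt_of_ne hne with hlt | hlt
      · refine hnot (y - x) (by linarith) (by linarith [hx.1, hy.2]) ?_
        have := L.sub_mem_lattice_of_eq (hnot' x hx) (hnot' y hy) h1 h2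
        push_cast
        rwa [sub_mul]
      · refine hnot (x - y) (by linarith) (by linarith [hx.2, hy.1]) ?_
        have := L.sub_mem_lattice_of_eq (hnot' y hy) (hnot' x hx) h1.symm h2.symm
        push_cast
        rwa [sub_mul]
    · have h3 := L.sub_mem_lattice_of_eq (a := -(x * c)) (b := y * c)
        (by simpa using hnot' x hx) (hnot' y hy) (by simpa using h1) (by simp [h2])
      by_contra hne
      have hlt : x + y < 2 * T := by
        rcases lt_or_gt_of_ne hne with hlt | hlt <;> linarith [hx.2, hy.2]
      refine hnot (x + y) (by linarith [hx.1, hy.1]) hlt ?_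
      push_cast
      rw [sub_neg_eq_add] at h3
      convert h3 using 1
      ring
  have hTmem : T ∈ Ioc 0 T := ⟨hT, le_rfl⟩
  have hfT : f T = σ * e₁ := by
    have := hf T
    rw [he, hc] at this
    exact_mod_cast this.symm
  have hlim : Tendsto f (𝓝[>] 0) atTop := by
    -- This also holds at $x=0$, since division by zero yields 0.
    have h1 : f = fun x : ℝ ↦ (c ^ 2 * L.weierstrassPExcept 0 (x * c)).re + (x ^ 2)⁻¹ := by
      ext x
      have := L.weierstrassPExcept_add 0 (x * c)
      simp only [ZeroMemClass.coe_zero, sub_zero] at this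
      simp only [f]
      rw [← this, mul_add, Complex.add_re]
      congr 1
      rw [mul_pow]
      by_cases hx : x = 0
      · simp [hx]
      · have hx' : (x : ℂ) ≠ 0 := by exact_mod_cast hx
        have : c ^ 2 * (1 / ((x : ℂ) ^ 2 * c ^ 2) - 1 / 0 ^ 2) = (((x ^ 2)⁻¹ : ℝ) : ℂ) := by
          push_cast
          field_simp
          simp
        rw [this, Complex.ofReal_re]
    rw [h1]
    have hcont : ContinuousAt (fun x : ℝ ↦ (c ^ 2 * L.weierstrassPExcept 0 (x * c)).re) 0 := by
      have h2 : ContinuousAt (fun x : ℝ ↦ L.weierstrassPExcept 0 (x * c)) 0 := by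
        refine ContinuousAt.comp (g := L.weierstrassPExcept 0) (f := fun x : ℝ ↦ (x * c : ℂ)) ?_
          (by fun_prop)
        simpa using (L.analyticAt_weierstrassPExcept 0).continuousAt
      exact Complex.continuous_re.continuousAt.comp (h2.const_mul (c ^ 2))
    refine (hcont.tendsto.mono_left nhdsWithin_le_nhds).add_atTop ?_
    have h3 := (tendsto_pow_atTop (α := ℝ) two_ne_zero).comp tendsto_inv_nhdsGT_zero
    simpa [Function.comp_def] using h3
  have hbig (v : ℝ) (x : ℝ) (hx : 0 < x) : ∃ y, 0 < y ∧ y < x ∧ v < f y := by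
    obtain ⟨y, h1, h2⟩ := ((hlim.eventually_gt_atTop v).and
      (Ioo_mem_nhdsGT hx)).exists
    exact ⟨y, h2.1, h2.2, h1⟩
  have hcont : ∀ y, 0 < y → ContinuousOn f (Icc y T) := fun y hy x hx ↦
    (hfd x ⟨hy.trans_le hx.1, hx.2⟩).continuousAt.continuousWithinAt
  have hgt : ∀ x ∈ Ioo 0 T, σ * e₁ < f x := by
    intro x hx
    obtain ⟨y, hy0, hyx, hy⟩ := hbig (f T) x hx.1
    have hanti := (hcont y hy0).strictAntiOn_of_injOn_Icc (by linarith [hx.2]) hy.le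
      (hinj.mono fun z (hz : z ∈ Icc y T) ↦ mem_Ioc.2 ⟨hy0.trans_le hz.1, hz.2⟩)
    rw [← hfT]
    exact hanti (mem_Icc.2 ⟨hyx.le, hx.2.le⟩) (right_mem_Icc.2 (hyx.trans hx.2).le) hx.2
  have hIVT : ∀ v, σ * e₁ < v → ∃ x ∈ Ioo 0 T, f x = v := by
    intro v hv
    obtain ⟨y, hy0, hyT, hy⟩ := hbig v T hT
    obtain ⟨x, hx, hxv⟩ := intermediate_value_Ioo' hyT.le (hcont y hy0)
      (mem_Ioo.2 ⟨hfT.trans_lt hv, hy⟩)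
    exact ⟨x, ⟨hy0.trans hx.1, hx.2⟩, hxv⟩
  have hne : ∀ x ∈ Ioo 0 T, f' x ≠ 0 := by
    intro x hx h
    have hx' := Ioo_subset_Ioc_self hx
    have h1 := hf' x hx'
    rw [h, Complex.ofReal_zero] at h1
    have h2 := (mul_eq_zero.1 h1).resolve_left (pow_ne_zero 3 hc0)
    have h3 := L.two_mul_mem_of_derivWeierstrassP_eq_zero (hnot' x hx') h2
    refine hnot (2 * x) (by linarith [hx.1]) (by linarith [hx.2]) ?_
    push_cast
    rwa [mul_assoc]
  -- A root $\sigma e$ above $\sigma e_1$ would be attained inside $(0,T)$ and make $f'$ vanish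
  -- there, but $\wp'$ vanishes only at half-periods.
  have hlt : ∀ e : ℝ, e₁ ≠ e → (∀ x ∈ Ioo 0 T, f x = σ * e → f' x = 0) → σ * e < σ * e₁ := by
    intro e hee h
    rcases lt_trichotomy (σ * e) (σ * e₁) with h1 | h1 | h1
    · exact h1
    · exact absurd (mul_left_cancel₀ hσ h1).symm hee
    · obtain ⟨x, hx, hxv⟩ := hIVT _ h1
      exact absurd (h x hx hxv) (hne x hx)
  have h2 := hlt e₂ h12 fun x hx h ↦ by
    have := hode x (Ioo_subset_Ioc_self hx)
    rw [h] at this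
    simpa using this
  have h3 := hlt e₃ h13 fun x hx h ↦ by
    have := hode x (Ioo_subset_Ioc_self hx)
    rw [h] at this
    simpa using this
  refine ⟨h2, h3, eq_ellipticIntegral_of_ode hT h2 h3
    (fun x hx ↦ hfd x (Ioo_subset_Ioc_self hx)) (fun x hx ↦ hode x (Ioo_subset_Ioc_self hx))
    (hinj.mono Ioo_subset_Ioc_self) ?_⟩
  ext v
  exact ⟨fun ⟨x, hx, h⟩ ↦ h ▸ hgt x hx, fun hv ↦ hIVT v hv⟩

lemma weierstrassP_conj (L : PeriodPair) (h : ∀ l ∈ L.lattice, conj l ∈ L.lattice) (z : ℂ) :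
    ℘[L] (conj z) = conj (℘[L] z) := by
  let e : L.lattice ≃ L.lattice :=
    { toFun l := ⟨conj l.1, h _ l.2⟩
      invFun l := ⟨conj l.1, h _ l.2⟩
      left_inv l := by simp
      right_inv l := by simp }
  rw [weierstrassP, ← e.tsum_eq, weierstrassP, Complex.conj_tsum]
  congr with l
  simp [e]

/-- The rectangular lattice spanned by `2a` and `2bi`. -/
noncomputable def rectangular (a b : ℝ) (ha : 0 < a) (hb : 0 < b) : PeriodPair where
  ω₁ := 2 * a
  ω₂ := 2 * (Complex.I * b)
  indep := by
    rw [LinearIndependent.pair_iff]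
    intro s t h
    have h1 := congrArg Complex.re h
    have h2 := congrArg Complex.im h
    simp at h1 h2
    exact ⟨h1.resolve_right ha.ne', h2.resolve_right hb.ne'⟩

lemma mem_rectangular {a b : ℝ} {ha : 0 < a} {hb : 0 < b} {z : ℂ} :
    z ∈ (rectangular a b ha hb).lattice ↔
      ∃ m n : ℤ, z.re = 2 * m * a ∧ z.im = 2 * n * b := by
  rw [mem_lattice]
  refine exists₂_congr fun m n ↦ ?_
  rw [eq_comm, Complex.ext_iff]
  refine and_congr ?_ ?_
  · simp [rectangular]; ring_nf
  · simp [rectangular]; ring_nf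

/-- The invariants of a rectangular lattice, and its periods as elliptic integrals. -/
lemma rectangular_spec {a b : ℝ} (ha : 0 < a) (hb : 0 < b) :
    ∃ e₁ e₂ e₃ : ℝ, e₃ < e₂ ∧ e₂ < e₁ ∧ e₁ + e₂ + e₃ = 0 ∧
      (rectangular a b ha hb).g₂ = -4 * (e₁ * e₂ + e₁ * e₃ + e₂ * e₃) ∧
      (rectangular a b ha hb).g₃ = 4 * e₁ * e₂ * e₃ ∧
      a = ellipticIntegral (e₁ - e₂) (e₁ - e₃) / 2 ∧
      b = ellipticIntegral (e₁ - e₃) (e₂ - e₃) / 2 := by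
  set L := rectangular a b ha hb
  have hconj : ∀ l ∈ L.lattice, conj l ∈ L.lattice := by
    intro l hl
    obtain ⟨m, n, h1, h2⟩ := mem_rectangular.1 hl
    exact mem_rectangular.2 ⟨m, -n, by simpa using h1, by simp [h2]⟩
  have hreal (z : ℂ) (h : conj z - z ∈ L.lattice) : (℘[L] z).im = 0 := by
    rw [← Complex.conj_eq_iff_im, ← L.weierstrassP_conj hconj]
    have := L.weierstrassP_add_coe z ⟨_, h⟩
    simpa using this
  have hneg (z : ℂ) (h : conj z + z ∈ L.lattice) : (℘[L] z).im = 0 := by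
    rw [← Complex.conj_eq_iff_im, ← L.weierstrassP_conj hconj, ← L.weierstrassP_neg z]
    have := L.weierstrassP_add_coe (-z) ⟨_, h⟩
    simpa using this
  have hodd : ∀ n : ℤ, (n : ℝ) * 2 ≠ 1 := fun n h ↦ by
    have : n * 2 = 1 := by exact_mod_cast h
    omega
  have ha' (m : ℤ) : a ≠ 2 * m * a := fun h ↦
    hodd m (mul_right_cancel₀ ha.ne' (by linear_combination -h))
  have hb' (m : ℤ) : b ≠ 2 * m * b := fun h ↦
    hodd m (mul_right_cancel₀ hb.ne' (by linear_combination -h))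
  set z₁ : ℂ := a * 1
  set z₃ : ℂ := b * Complex.I
  set z₂ : ℂ := z₁ + z₃
  have n1 : z₁ ∉ L.lattice := fun h ↦ by
    obtain ⟨m, n, h1, h2⟩ := mem_rectangular.1 h
    exact ha' m (by simpa [z₁] using h1)
  have n3 : z₃ ∉ L.lattice := fun h ↦ by
    obtain ⟨m, n, h1, h2⟩ := mem_rectangular.1 h
    exact hb' n (by simpa [z₃] using h2)
  have n2 : z₂ ∉ L.lattice := fun h ↦ by
    obtain ⟨m, n, h1, h2⟩ := mem_rectangular.1 h
    exact ha' m (by simpa [z₁, z₂, z₃] using h1)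
  have t1 : 2 * z₁ ∈ L.lattice := mem_rectangular.2 ⟨1, 0, by simp [z₁], by simp [z₁]⟩
  have t3 : 2 * z₃ ∈ L.lattice := mem_rectangular.2 ⟨0, 1, by simp [z₃], by simp [z₃]⟩
  have t2 : 2 * z₂ ∈ L.lattice := by
    simp only [z₂, mul_add]; exact add_mem t1 t3
  have d12 : ℘[L] z₁ ≠ ℘[L] z₂ := fun h ↦ n3 <| by
    simpa [z₂] using L.sub_mem_lattice_of_half_periods n1 n2 t1 t2 h
  have d32 : ℘[L] z₃ ≠ ℘[L] z₂ := fun h ↦ n1 <| by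
    simpa [z₂] using L.sub_mem_lattice_of_half_periods n3 n2 t3 t2 h
  have d13 : ℘[L] z₁ ≠ ℘[L] z₃ := fun h ↦ n2 <| by
    have := add_mem (L.sub_mem_lattice_of_half_periods n1 n3 t1 t3 h) t1
    convert this using 1
    simp only [z₂]; ring
  have r1 (x : ℝ) : (℘[L] (x * 1)).im = 0 := hreal _ (by simp)
  have r3 (x : ℝ) : (℘[L] (x * Complex.I)).im = 0 := hneg _ (by simp)
  have r2 : (℘[L] z₂).im = 0 := hneg _ (by
    convert t1 using 1
    simp [z₂, z₁, z₃]; ring)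
  obtain ⟨e₁, he₁⟩ : ∃ e : ℝ, ℘[L] z₁ = e := ⟨_, (Complex.conj_eq_iff_real.1
    (Complex.conj_eq_iff_im.2 (r1 a))).choose_spec⟩
  obtain ⟨e₂, he₂⟩ : ∃ e : ℝ, ℘[L] z₂ = e := ⟨_, (Complex.conj_eq_iff_real.1
    (Complex.conj_eq_iff_im.2 r2)).choose_spec⟩
  obtain ⟨e₃, he₃⟩ : ∃ e : ℝ, ℘[L] z₃ = e := ⟨_, (Complex.conj_eq_iff_real.1
    (Complex.conj_eq_iff_im.2 (r3 b))).choose_spec⟩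
  have root {z : ℂ} (hz : z ∉ L.lattice) (h2 : 2 * z ∈ L.lattice) :
      4 * ℘[L] z ^ 3 - L.g₂ * ℘[L] z - L.g₃ = 0 := by
    rw [← L.derivWeierstrassP_sq z hz, L.derivWeierstrassP_eq_zero_of_two_mul_mem h2]
    simp
  have q1 := root n1 t1
  have q2 := root n2 t2
  have q3 := root n3 t3
  rw [he₁] at q1 d12 d13
  rw [he₂] at q2 d12 d32
  rw [he₃] at q3 d13 d32
  -- Dividing differences of the three cubic equations by differences of roots yields Vieta's
  -- relations.
  have s12 : 4 * ((e₁ : ℂ) ^ 2 + e₁ * e₂ + e₂ ^ 2) - L.g₂ = 0 :=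
    mul_left_cancel₀ (sub_ne_zero.2 d12) (by linear_combination q1 - q2)
  have s13 : 4 * ((e₁ : ℂ) ^ 2 + e₁ * e₃ + e₃ ^ 2) - L.g₂ = 0 :=
    mul_left_cancel₀ (sub_ne_zero.2 d13) (by linear_combination q1 - q3)
  have hs : (e₁ : ℂ) + e₂ + e₃ = 0 :=
    mul_left_cancel₀ (sub_ne_zero.2 d32) (by linear_combination (s13 - s12) / 4)
  have hg2 : L.g₂ = -4 * ((e₁ : ℂ) * e₂ + e₁ * e₃ + e₂ * e₃) := by
    linear_combination -s12 + 4 * (e₁ + e₂) * hs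
  have hg3 : L.g₃ = 4 * (e₁ : ℂ) * e₂ * e₃ := by
    linear_combination -q1 - e₁ * hg2 + 4 * (e₁ : ℂ) ^ 2 * hs
  have hcubic (x : ℂ) : 4 * x ^ 3 - L.g₂ * x - L.g₃ = 4 * (x - e₁) * (x - e₂) * (x - e₃) := by
    rw [hg2, hg3]
    linear_combination 4 * x ^ 2 * hs
  have c12 : e₁ ≠ e₂ := fun h ↦ d12 (by rw [h])
  have c13 : e₁ ≠ e₃ := fun h ↦ d13 (by rw [h])
  have c32 : e₃ ≠ e₂ := fun h ↦ d32 (by rw [h])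
  obtain ⟨u1, u2, u3⟩ := L.real_ray (c := 1) (σ := 1) (T := a) (e₁ := e₁) (e₂ := e₂) (e₃ := e₃)
    ha (by simp) one_ne_zero
    (fun x hx ↦ by
      obtain ⟨m, n, h1, h2⟩ := mem_rectangular.1 hx
      exact ⟨m, by simpa using h1⟩) t1 r1 he₁ c12 c13 hcubic
  -- On the imaginary axis $\sigma=-1$ reverses the order, so $e_3$ is the smallest root.
  obtain ⟨v1, v2, v3⟩ := L.real_ray (c := Complex.I) (σ := -1) (T := b) (e₁ := e₃) (e₂ := e₁)
    (e₃ := e₂) hb (by simp) (by simp)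
    (fun x hx ↦ by
      obtain ⟨m, n, h1, h2⟩ := mem_rectangular.1 hx
      exact ⟨n, by simpa using h2⟩) t3 r3 he₃ c13.symm c32 (fun x ↦ by rw [hcubic]; ring)
  refine ⟨e₁, e₂, e₃, by linarith, by linarith, by exact_mod_cast hs, hg2, hg3, ?_, ?_⟩
  · simpa using u3
  · convert v3 using 3 <;> ring

end PeriodPair

/-! ### Identification of the lattice and of its fundamental pair. -/

section Periods

open Real

/-- With $k=\sqrt{1-\kappa^2}$, the numbers $\sqrt{1+k}$ and $\sqrt{1-k}$ have product $\kappa$ and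
squared arithmetic mean $(1+\kappa)/2$; Gauss' transformation leads to $E(1+k,1-k)$. -/
lemma ellipticIntegral_complementary {κ : ℝ} (h0 : 0 < κ) (h1 : κ < 1) :
    ellipticIntegral ((1 + κ) / 2) κ =
      π * ₂F₁ (1 / 4 : ℝ) (3 / 4 : ℝ) (1 : ℝ) (1 - κ ^ 2) := by
  have hκ : 0 < 1 - κ ^ 2 := by nlinarith
  set k := √(1 - κ ^ 2)
  have hk2 : k ^ 2 = 1 - κ ^ 2 := sq_sqrt hκ.le
  have hk0 : 0 ≤ k := sqrt_nonneg _
  have hk1 : k < 1 := by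
    rw [sqrt_lt' one_pos]
    have := pow_pos h0 2
    linarith
  have p1 : 0 < 1 + k := by linarith
  have p2 : 0 < 1 - k := by linarith
  have hxy : √(1 + k) * √(1 - k) = κ := by
    rw [← sqrt_mul p1.le, show (1 + k) * (1 - k) = κ ^ 2 by linear_combination -hk2,
      sqrt_sq h0.le]
  have h := ellipticIntegral_agm (sqrt_pos.2 p1) (sqrt_pos.2 p2)
  rw [sq_sqrt p1.le, sq_sqrt p2.le, hxy, ellipticIntegral_eq_hypergeometric hk0 hk1, hk2] at h
  rw [← h]
  congr 1
  linear_combination -(1 / 4) * sq_sqrt p1.le - (1 / 4) * sq_sqrt p2.le - (1 / 2) * hxy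

/-- The rectangular lattice with half-periods given by hypergeometric functions has the expected
roots `1/6`, `(-1 + 3κ)/12`, `(-1 - 3κ)/12`. -/
lemma rectangular_invariants {κ a b : ℝ} (h0 : 0 < κ) (h1 : κ < 1) (ha : 0 < a) (hb : 0 < b)
    (ha' : a = π * ₂F₁ (1 / 4 : ℝ) (3 / 4 : ℝ) (1 : ℝ) (κ ^ 2))
    (hb' : b = 1 / √2 * π * ₂F₁ (1 / 4 : ℝ) (3 / 4 : ℝ) (1 : ℝ) (1 - κ ^ 2)) :
    (PeriodPair.rectangular a b ha hb).g₂ = 1 / 12 * (1 + 3 * (κ : ℂ) ^ 2) ∧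
      (PeriodPair.rectangular a b ha hb).g₃ = 1 / 216 * (1 - 9 * (κ : ℂ) ^ 2) := by
  obtain ⟨e₁, e₂, e₃, h32, h21, hsum, hg2, hg3, hae, hbe⟩ := PeriodPair.rectangular_spec ha hb
  have he1 : 0 < e₁ := by linarith
  -- Roots of sum zero are fixed by a scale $c$ and a shape $k$: $e_1=\tfrac23c^2$ and
  -- $e_2-e_3=2c^2k$. The bound $k<1$ amounts to $e_2<e_1$.
  obtain ⟨k, hk⟩ : ∃ k, k = (e₂ - e₃) / (3 * e₁) := ⟨_, rfl⟩
  have hk3 : e₂ - e₃ = 3 * k * e₁ := by rw [hk]; field_simp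
  have hk0 : 0 < k := by rw [hk]; exact div_pos (by linarith) (by linarith)
  have hk1 : k < 1 := by rw [hk, div_lt_one (by linarith)]; linarith
  obtain ⟨c, hc0, hc⟩ : ∃ c : ℝ, 0 < c ∧ c ^ 2 = 3 / 2 * e₁ :=
    ⟨√(3 / 2 * e₁), sqrt_pos.2 (by linarith), sq_sqrt (by linarith)⟩
  have s2 : (0 : ℝ) < √2 := by positivity
  have s22 : √2 ^ 2 = (2 : ℝ) := sq_sqrt (by norm_num)
  rw [show e₁ - e₂ = c ^ 2 * (1 - k) by rw [hc]; linear_combination -(hsum + hk3) / 2,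
    show e₁ - e₃ = c ^ 2 * (1 + k) by rw [hc]; linear_combination (hk3 - hsum) / 2,
    ellipticIntegral_scale hc0, ellipticIntegral_comm,
    ellipticIntegral_eq_hypergeometric hk0.le hk1] at hae
  -- Scaling by $\sqrt2\,c$ instead of $c$ produces the factor $1/\sqrt2$ in the imaginary period.
  rw [show e₁ - e₃ = (√2 * c) ^ 2 * ((1 + k) / 2) by
      rw [mul_pow, hc, s22]; linear_combination (hk3 - hsum) / 2,
    show e₂ - e₃ = (√2 * c) ^ 2 * k by rw [mul_pow, hc, s22]; linear_combination hk3,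
    ellipticIntegral_scale (by positivity), ellipticIntegral_complementary hk0 hk1] at hbe
  have pos {x : ℝ} (hx0 : 0 < x) (hx1 : x < 1) := hypergeometric_pos (x := x ^ 2)
    (by positivity) (by nlinarith)
  have pos' {x : ℝ} (hx0 : 0 < x) (hx1 : x < 1) := hypergeometric_pos (x := 1 - x ^ 2)
    (by nlinarith) (by nlinarith)
  have mono {x y : ℝ} (hx0 : 0 < x) (hxy : x < y) (hy1 : y < 1) :=
    hypergeometric_strictMono (x := x ^ 2) (y := y ^ 2) (by positivity) (by nlinarith)
      (by nlinarith)
  have mono' {x y : ℝ} (hx0 : 0 < x) (hxy : x < y) (hy1 : y < 1) :=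
    hypergeometric_strictMono (x := 1 - y ^ 2) (y := 1 - x ^ 2) (by nlinarith) (by nlinarith)
      (by nlinarith)
  set F : ℝ → ℝ := ₂F₁ (1 / 4 : ℝ) (3 / 4 : ℝ) (1 : ℝ)
  have ea : 2 * c * F (κ ^ 2) = F (k ^ 2) := by
    rw [ha'] at hae
    field_simp at hae
    linarith
  have eb : 2 * c * F (1 - κ ^ 2) = F (1 - k ^ 2) := by
    rw [hb'] at hbe
    field_simp at hbe
    linarith
  -- If $k<\kappa$, then `ea` forces $2c<1$ and `eb` forces $2c>1$; the case $k>\kappa$ is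
  -- symmetric.
  have hkκ : k = κ := by
    rcases lt_trichotomy k κ with h | h | h
    · have m1 := mono hk0 h h1
      have m2 := mono' hk0 h h1
      have q1 := pos h0 h1
      have q2 := pos' h0 h1
      rw [← ea] at m1
      rw [← eb] at m2
      have := lt_of_mul_lt_mul_right (m1.trans_eq (one_mul _).symm) q1.le
      have := lt_of_mul_lt_mul_right ((one_mul _).trans_lt m2) q2.le
      linarith
    · exact h
    · have m1 := mono h0 h hk1
      have m2 := mono' h0 h hk1
      have q1 := pos h0 h1
      have q2 := pos' h0 h1
      rw [← ea] at m1
      rw [← eb] at m2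
      have := lt_of_mul_lt_mul_right ((one_mul _).trans_lt m1) q1.le
      have := lt_of_mul_lt_mul_right (m2.trans_eq (one_mul _).symm) q2.le
      linarith
  rw [hkκ] at ea
  have hc2 : c = 1 / 2 := by
    have := pos h0 h1
    have h3 : 2 * c = 1 := mul_right_cancel₀ this.ne' (by linear_combination ea)
    linarith
  have v1 : e₁ = 1 / 6 := by
    rw [hc2] at hc
    linarith
  rw [hkκ, v1] at hk3
  rw [v1] at hsum
  have v2 : e₂ = (-1 + 3 * κ) / 12 := by linarith
  have v3 : e₃ = (-1 - 3 * κ) / 12 := by linarith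
  rw [hg2, hg3, v1, v2, v3]
  push_cast
  constructor <;> ring

lemma eq_of_eq_int_mul {x y : ℝ} (hx : 0 < x) (hy : 0 < y) {m n : ℤ}
    (h1 : x = m * y) (h2 : y = n * x) : x = y := by
  have hm : (0 : ℝ) < m := pos_of_mul_pos_left (h1 ▸ hx) hy.le
  have h3 : (n * m : ℝ) = 1 := by
    have : (n * m : ℝ) * y = 1 * y := by rw [mul_assoc, ← h1, ← h2, one_mul]
    exact mul_right_cancel₀ hy.ne' this
  have h4 : m ∣ 1 := ⟨n, by rw [mul_comm]; exact_mod_cast h3.symm⟩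
  have h5 : m = 1 := Int.eq_one_of_dvd_one (by exact_mod_cast hm.le) h4
  rw [h1, h5]
  simp

/-- The fundamental pairs of the `℘`-function of a rectangular lattice with a positive and a
positive imaginary member. -/
lemma PeriodPair.isFundamentalPair_rectangular_iff {a b : ℝ} (ha : 0 < a) (hb : 0 < b)
    (Ω Ω' : ℂ) :
    (IsFundamentalPair (rectangular a b ha hb).weierstrassP (2 * Ω) (2 * Ω') ∧
      (Ω.im = 0 ∧ 0 < Ω.re) ∧ (Ω'.re = 0 ∧ 0 < Ω'.im)) ↔ Ω = a ∧ Ω' = Complex.I * b := by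
  constructor
  · rintro ⟨⟨-, hper⟩, ⟨hi, hr⟩, ⟨hr', hi'⟩⟩
    simp only [periodic_weierstrassP_iff] at hper
    obtain ⟨m, n, h1, h2⟩ := mem_rectangular.1 ((hper (2 * Ω)).2 ⟨1, 0, by simp⟩)
    obtain ⟨m', n', h1', h2'⟩ := mem_rectangular.1 ((hper (2 * Ω')).2 ⟨0, 1, by simp⟩)
    obtain ⟨p, q, h3⟩ := (hper (2 * a)).1 (mem_rectangular.2 ⟨1, 0, by simp, by simp⟩)
    obtain ⟨p', q', h3'⟩ := (hper (2 * (Complex.I * b))).1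
      (mem_rectangular.2 ⟨0, 1, by simp, by simp⟩)
    have h4 := congrArg Complex.re h3
    have h4' := congrArg Complex.im h3'
    simp [hr'] at h1 h4
    simp [hi] at h2' h4'
    -- On each axis the two positive generators are integer multiples of each other, hence equal.
    have k1 := eq_of_eq_int_mul hr ha (m := m) (n := p) (by linarith) (by linarith)
    have k2 := eq_of_eq_int_mul hi' hb (m := n') (n := q') (by linarith) (by linarith)
    exact ⟨Complex.ext (by simpa using k1) (by simpa using hi),
      Complex.ext (by simpa using hr') (by simpa using k2)⟩
  · rintro ⟨rfl, rfl⟩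
    refine ⟨⟨(rectangular a b ha hb).indep, fun w ↦ ?_⟩, by simpa using ha, by simpa using hb⟩
    rw [periodic_weierstrassP_iff, mem_lattice]
    simp only [rectangular, eq_comm]

end Periods

theorem theoremO (κ : ℝ) (hκ0 : 0 < κ) (hκ1 : κ < 1) :
    (∃! P : ℂ → ℂ,
      IsWeierstrassP (1 / 12 * (1 + 3 * (κ : ℂ) ^ 2)) (1 / 216 * (1 - 9 * (κ : ℂ) ^ 2)) P) ∧
    ∀ P : ℂ → ℂ,
      IsWeierstrassP (1 / 12 * (1 + 3 * (κ : ℂ) ^ 2)) (1 / 216 * (1 - 9 * (κ : ℂ) ^ 2)) P →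
      ∀ Ω Ω' : ℂ,
        (IsFundamentalPair P (2 * Ω) (2 * Ω') ∧
            (Ω.im = 0 ∧ 0 < Ω.re) ∧ (Ω'.re = 0 ∧ 0 < Ω'.im)) ↔
          (Ω = ((Real.pi * ₂F₁ (1 / 4 : ℝ) (3 / 4 : ℝ) (1 : ℝ) (κ ^ 2) : ℝ) : ℂ) ∧
            Ω' = Complex.I *
              ((1 / √2 * Real.pi * ₂F₁ (1 / 4 : ℝ) (3 / 4 : ℝ) (1 : ℝ) (1 - κ ^ 2) : ℝ) : ℂ)) := by
  have hκ2 : 0 < κ ^ 2 := by positivity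
  have hκ3 : κ ^ 2 < 1 := by nlinarith
  have ha : 0 < Real.pi * ₂F₁ (1 / 4 : ℝ) (3 / 4 : ℝ) (1 : ℝ) (κ ^ 2) :=
    mul_pos Real.pi_pos (hypergeometric_pos hκ2 hκ3)
  have hb : 0 < 1 / √2 * Real.pi * ₂F₁ (1 / 4 : ℝ) (3 / 4 : ℝ) (1 : ℝ) (1 - κ ^ 2) :=
    mul_pos (mul_pos (by positivity) Real.pi_pos)
      (hypergeometric_pos (by linarith) (by linarith))
  obtain ⟨h2, h3⟩ := rectangular_invariants hκ0 hκ1 ha hb rfl rfl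
  have huniq : ∀ P : ℂ → ℂ,
      IsWeierstrassP (1 / 12 * (1 + 3 * (κ : ℂ) ^ 2)) (1 / 216 * (1 - 9 * (κ : ℂ) ^ 2)) P →
      P = (PeriodPair.rectangular _ _ ha hb).weierstrassP := by
    rintro P ⟨M, hM2, hM3, rfl⟩
    exact PeriodPair.weierstrassP_eq_of_lattice_eq
      (PeriodPair.lattice_eq_of_g_eq (hM2.trans h2.symm) (hM3.trans h3.symm))
  refine ⟨⟨_, ⟨_, h2, h3, rfl⟩, huniq⟩, fun P hP Ω Ω' ↦ ?_⟩
  rw [huniq P hP]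
  exact PeriodPair.isFundamentalPair_rectangular_iff ha hb Ω Ω'
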